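/- \textbf{Bilateral extension of Liu's transformation.} Let $q\in\mathbb C$ with $0<|q|<1$. Write $(a;q)_\infty=\prod_{k\ge 0}(1-aq^k)$, and for $n\in\mathbb Z$ let $(a;q)_n=(a;q)_\infty/(aq^n;q)_\infty$, that is, $(a;q)_n=\prod_{k=0}^{n-1}(1-aq^k)$ for $n\ge 0$ and $(a;q)_{-n}=\prod_{k=1}^{n}(1-aq^{-k})^{-1}$ for $n\ge1$ (so that $1/(a;q)_{-n}=\prod_{k=1}^{n}(1-aq^{-k})$ always). Put $(a_1,\dots,a_m;q)_n=\prod_i (a_i;q)_n$, also for $n=\infty$, and $${}_4\phi_3\left[\begin{matrix}a_1,a_2,a_3,a_4\\ b_1,b_2,b_3\end{matrix};q,x\right]=\sum_{k\ge0}\frac{(a_1,a_2,a_3,a_4;q)_k}{(b_1,b_2,b_3;q)_k}\frac{x^k}{(q;q)_k}.$$ Let $b,c,d,\beta,\gamma\in\mathbb C$ with $b,c,d\ne0$, such that none of $b,\ c,\ d,\ q/b,\ q/c,\ \beta\gamma bc/q$ is of the form $q^{-k}$ with $k\in\{0,1,2,\dots\}$, and suppose that $|bcd/q^2|<1$. For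 $n\in\mathbb Z$ put $$G(n;\beta,\gamma)={}_4\phi_3\left[\begin{matrix}q^{-n},\,q^n,\,\beta,\,\gamma\\ q/b,\ q/c,\ \beta\gamma bc/q\end{matrix};q,q\right].$$ Then $$\sum_{n=-\infty}^{\infty}G(n;\beta,\gamma)\frac{(q/b,q/c,q/d;q)_n}{(b,c,d;q)_n}\left(\frac{bcd}{q^2}\right)^n=\frac{(q,\ \beta bc/q,\ \gamma bc/q,\ bd/q,\ cd/q,\ \beta\gamma bcd/q^2;q)_\infty}{(b,\ c,\ d,\ \beta\gamma bc/q,\ \beta bcd/q^2,\ \gamma bcd/q^2;q)_\infty}$$ in each of the following cases: (i) $|\beta bcd/q^2|<1$ and $|\gamma bcd/q^2|<1$; in this case the bilateral series converges absolutely; (ii) more generally, whenever the bilateral series converges absolutely and neither $\beta bcd/q^2$ nor $\gamma bcd/q^2$ is of the form $q^{-k}$ with $k\in\{0,1,2,\dots\}$ (so that the right-hand side is defined). -/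

import Mathlib

/-- The infinite `q`-shifted factorial `(a; q)_∞ = ∏_{k ≥ 0} (1 - a q^k)`. -/
noncomputable def qPochInf (a q : ℂ) : ℂ := ∏' k : ℕ, (1 - a * q ^ k)

/-- The `q`-shifted factorial `(a; q)_n` for `n : ℤ`. It is `∏_{0 ≤ k < n} (1 - a q^k)` for `n ≥ 0`
and `1 / ∏_{1 ≤ k ≤ m} (1 - a q^{-k})` for `n = -m < 0`; see `qPoch_eq_div` for the agreement
with `(a; q)_∞ / (a q^n; q)_∞`. -/
noncomputable def qPoch (a q : ℂ) : ℤ → ℂ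
  | Int.ofNat n => ∏ k ∈ Finset.range n, (1 - a * q ^ k)
  | Int.negSucc m => (∏ k ∈ Finset.range (m + 1), (1 - a * q ^ (-((k : ℤ) + 1))))⁻¹

/-- The multi-factorial `(a₁, …, a_m; q)_n`. -/
noncomputable def qPochs (as : List ℂ) (q : ℂ) (n : ℤ) : ℂ :=
  (as.map fun a => qPoch a q n).prod

/-- The multi-factorial `(a₁, …, a_m; q)_∞`. -/
noncomputable def qPochsInf (as : List ℂ) (q : ℂ) : ℂ :=
  (as.map fun a => qPochInf a q).prod

/-- The basic hypergeometric series `_r φ_s [a₁, …, a_r; b₁, …, b_s; q, x]`. -/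
noncomputable def basicHyp (as bs : List ℂ) (q x : ℂ) : ℂ :=
  ∑' n : ℕ, qPochs as q n / qPochs bs q n
    * ((-1) ^ n * q ^ (n.choose 2)) ^ ((bs.length : ℤ) + 1 - as.length) * (x ^ n / qPoch q q n)

/-- `G(n; β, γ) = ₄φ₃ [q^{-n}, q^n, β, γ; q/b, q/c, βγbc/q; q, q]`. -/
noncomputable def liuG (q b c β γ : ℂ) (n : ℤ) : ℂ :=
  basicHyp [q ^ (-n), q ^ n, β, γ] [q / b, q / c, β * γ * b * c / q] q q

theorem multipliable_qPochInf (a : ℂ) {q : ℂ} (hq : ‖q‖ < 1) :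
    Multipliable fun k : ℕ => 1 - a * q ^ k := by
  have h : Summable fun k : ℕ => ‖-(a * q ^ k)‖ := by
    simp only [norm_neg, norm_mul, norm_pow]
    exact (summable_geometric_of_lt_one (norm_nonneg q) hq).mul_left _
  simpa [sub_eq_add_neg] using multipliable_one_add_of_summable h

theorem prod_mul_qPochInf (a : ℂ) {q : ℂ} (hq : ‖q‖ < 1) (n : ℕ) :
    (∏ k ∈ Finset.range n, (1 - a * q ^ k)) * qPochInf (a * q ^ n) q = qPochInf a q := by
  have h : Multipliable fun k : ℕ => 1 - a * q ^ (k + n) := by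
    have := multipliable_qPochInf (a * q ^ n) hq
    refine this.congr fun k => ?_
    rw [pow_add]; ring
  have h2 := h.prod_mul_tprod_nat_mul' (f := fun k : ℕ => 1 - a * q ^ k)
  rw [qPochInf, qPochInf, ← h2]
  congr 1
  refine tprod_congr fun k => ?_
  rw [pow_add]; ring

theorem qPoch_eq_div (a : ℂ) {q : ℂ} (hq0 : q ≠ 0) (hq : ‖q‖ < 1) (n : ℤ)
    (h : qPochInf (a * q ^ n) q ≠ 0) :
    qPoch a q n = qPochInf a q / qPochInf (a * q ^ n) q := by
  rw [eq_div_iff h]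
  cases n with
  | ofNat n => simpa [qPoch] using prod_mul_qPochInf a hq n
  | negSucc m =>
    have h1 := prod_mul_qPochInf (a * q ^ (Int.negSucc m)) hq (m + 1)
    have h2 : a * q ^ (Int.negSucc m) * q ^ (m + 1) = a := by
      rw [zpow_negSucc, mul_assoc, inv_mul_cancel₀ (pow_ne_zero _ hq0), mul_one]
    have h3 : ∏ k ∈ Finset.range (m + 1), (1 - a * q ^ (Int.negSucc m) * q ^ k)
        = ∏ k ∈ Finset.range (m + 1), (1 - a * q ^ (-((k : ℤ) + 1))) := by
      rw [← Finset.prod_range_reflect]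
      refine Finset.prod_congr rfl fun k hk => ?_
      have hk' : k ≤ m := by have := Finset.mem_range.mp hk; omega
      rw [mul_assoc, ← zpow_natCast, ← zpow_add₀ hq0]
      congr 3
      rw [Int.negSucc_eq]
      omega
    rw [h2, h3] at h1
    have h4 : (∏ k ∈ Finset.range (m + 1), (1 - a * q ^ (-((k : ℤ) + 1)))) ≠ 0 := by
      intro h0
      rw [← h3] at h0
      obtain ⟨k, hk, hk0⟩ := Finset.prod_eq_zero_iff.mp h0
      apply h
      have := prod_mul_qPochInf (a * q ^ (Int.negSucc m)) hq (k + 1)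
      rw [← this, Finset.prod_range_succ, hk0]
      ring
    rw [qPoch, ← h1, inv_mul_cancel_left₀ h4]

/-!
Write `w_n(d) = (q/b, q/c, q/d; q)_n (bcd/q²)^n / (b, c, d; q)_n`, so that the bilateral series is
`S(d) = ∑ w_n(d) G(n; β, γ)`. The proof evaluates `S(d)` by a first-order `q`-difference equation
in `d`, in the following way.

* `G(n; β, γ)` is an Askey–Wilson polynomial of degree `n` and satisfies a three-term recurrence
  in `n` (`liuG_recurrence`), an eigenvalue equation with eigenvalue `-(1 - β)(1 - γ)`. It holds
  for partial sums with an explicit remainder (`liuPartial_recurrence`), which vanishes once the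
  series has terminated.
* Apart from boundary terms, summation by parts moves the recurrence operator onto the weight, and
  the adjoint operator maps `w(d)` to a combination of `w(d)` and `w(dq)`
  (`weight_adjoint_identity`). With `s = bcd/q²` this gives
  `(1 - d)(1 - βs)(1 - γs) S(d) = (1 - bd/q)(1 - cd/q)(1 - βγs) S(dq)`
  (`tsum_foldedTerm_contiguous`). The boundary terms tend to `0` as soon as the series for `d`
  converges absolutely, so nothing is required of the size of `βs` and `γs`.
* Iteration expresses `S(d)` through `lim S(d q^N) = S(0)`, where the terms of `S(0)` are the limits
  of those of `S(d)` (`tsum_foldedTerm_eq_zero_value`). The passage to the limit is by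
  domination: by the recurrence, `G(n; β, γ) = O(ρ^n)` for every `ρ > max(‖β‖, ‖γ‖)`
  (`exists_norm_liuG_le`). The same bound shows that the series converges if `‖βs‖ < 1` and
  `‖γs‖ < 1`.
* At `d = q` the series reduces to its term `n = 0`, which gives `S(0)`
  (`tsum_foldedTerm_zero`).

The weights satisfy `w_{-n}(d) = q^n w_n(d)` and `G` is even in `n`; the bilateral series is
therefore folded into a series over `n ≥ 0` with the additional factor `1 + q^n` for `n ≥ 1`
(`foldedTerm`).
-/

/-! ### The three-term recurrence for partial sums -/

/-- The symmetric Laurent polynomial `(x⁻¹; q)_k (x; q)_k`, in which the `k`-th term of `G(n; β, γ)` is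
expressed at `x = q ^ n`. -/
noncomputable def symPoch (q x : ℂ) (k : ℕ) : ℂ :=
  ∏ i ∈ Finset.range k, ((1 - x⁻¹ * q ^ i) * (1 - x * q ^ i))

/-- The coefficient `(β, γ; q)_k q^k / (q/b, q/c, βγbc/q, q; q)_k` of `symPoch q (q ^ n) k` in
`G(n; β, γ)`. -/
noncomputable def liuCoeff (q b c β γ : ℂ) (k : ℕ) : ℂ :=
  ∏ i ∈ Finset.range k, ((1 - β * q ^ i) * (1 - γ * q ^ i) * q /
    ((1 - q / b * q ^ i) * (1 - q / c * q ^ i) * (1 - β * γ * b * c / q * q ^ i)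
      * (1 - q * q ^ i)))

/-- The partial sum of `G(n; β, γ)` over `k ≤ K`, with `q ^ n` replaced by a free variable `x`. -/
noncomputable def liuPartial (q b c β γ : ℂ) (K : ℕ) (x : ℂ) : ℂ :=
  ∑ k ∈ Finset.range (K + 1), liuCoeff q b c β γ k * symPoch q x k

/-- The coefficient of `G(n + 1)` in the three-term recurrence, as a function of `x = q ^ n`. -/
noncomputable def upCoeff (q b c β γ x : ℂ) : ℂ :=
  (1 - x * q / b) * (1 - x * q / c) * (1 - β * γ * b * c / q * x) / (1 - q * x ^ 2)

/-- The coefficient of `G(n - 1)` in the three-term recurrence, as a function of `x = q ^ n`. -/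
noncomputable def downCoeff (q b c β γ x : ℂ) : ℂ :=
  (x - q / b) * (x - q / c) * (x - β * γ * b * c / q) / (x ^ 2 - q)

theorem qPoch_natCast (a q : ℂ) (n : ℕ) :
    qPoch a q (n : ℤ) = ∏ k ∈ Finset.range n, (1 - a * q ^ k) := rfl

theorem symPoch_succ (q x : ℂ) (k : ℕ) :
    symPoch q x (k + 1) = symPoch q x k * ((1 - x⁻¹ * q ^ k) * (1 - x * q ^ k)) :=
  Finset.prod_range_succ _ _

theorem symPoch_inv (q x : ℂ) (k : ℕ) : symPoch q x⁻¹ k = symPoch q x k := by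
  simp only [symPoch, inv_inv]
  exact Finset.prod_congr rfl fun i _ => mul_comm _ _

theorem symPoch_pow_eq_zero {q : ℂ} (hq0 : q ≠ 0) {n k : ℕ} (h : n < k) :
    symPoch q (q ^ n) k = 0 := by
  refine Finset.prod_eq_zero (Finset.mem_range.mpr h) ?_
  rw [inv_mul_cancel₀ (pow_ne_zero _ hq0)]
  ring

theorem symPoch_shift_up {q x : ℂ} (hq0 : q ≠ 0) (hx0 : x ≠ 0) (k : ℕ) :
    (1 - x) * symPoch q (q * x) (k + 1)
      = symPoch q x k * ((1 - (q * x)⁻¹) * (1 - x * q ^ k) * (1 - x * q ^ (k + 1))) := by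
  have h1 : ∏ i ∈ Finset.range (k + 1), (1 - (q * x)⁻¹ * q ^ i)
      = (∏ i ∈ Finset.range k, (1 - x⁻¹ * q ^ i)) * (1 - (q * x)⁻¹) := by
    rw [Finset.prod_range_succ']
    congr 1
    · refine Finset.prod_congr rfl fun i _ => ?_
      field_simp
      ring
    · simp
  have h2 : (1 - x) * ∏ i ∈ Finset.range (k + 1), (1 - q * x * q ^ i)
      = (∏ i ∈ Finset.range k, (1 - x * q ^ i)) * (1 - x * q ^ k) * (1 - x * q ^ (k + 1)) := by
    rw [← Finset.prod_range_succ, ← Finset.prod_range_succ, mul_comm]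
    conv_rhs => rw [Finset.prod_range_succ']
    congr 1
    · refine Finset.prod_congr rfl fun i _ => ?_
      ring
    · simp
  rw [symPoch, symPoch, Finset.prod_mul_distrib, Finset.prod_mul_distrib, h1]
  linear_combination (∏ i ∈ Finset.range k, (1 - x⁻¹ * q ^ i)) * (1 - (q * x)⁻¹) * h2

theorem symPoch_shift_down {q x : ℂ} (hq0 : q ≠ 0) (hx0 : x ≠ 0) (k : ℕ) :
    (1 - x⁻¹) * symPoch q (x / q) (k + 1)
      = symPoch q x k * ((1 - x / q) * (1 - x⁻¹ * q ^ k) * (1 - x⁻¹ * q ^ (k + 1))) := by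
  have h := symPoch_shift_up hq0 (inv_ne_zero hx0) k
  rw [symPoch_inv, ← symPoch_inv q (q * x⁻¹)] at h
  have e : (q * x⁻¹)⁻¹ = x / q := by field_simp
  rwa [e] at h

theorem liuCoeff_succ (q b c β γ : ℂ) (k : ℕ) :
    liuCoeff q b c β γ (k + 1) = liuCoeff q b c β γ k *
      ((1 - β * q ^ k) * (1 - γ * q ^ k) * q /
        ((1 - q / b * q ^ k) * (1 - q / c * q ^ k) * (1 - β * γ * b * c / q * q ^ k)
          * (1 - q * q ^ k))) :=
  Finset.prod_range_succ _ _

/-- The recurrence for the partial sums, at a generic `x` in place of `q ^ n`. The remainder has the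
factor `symPoch q x K`, which vanishes at `x = q ^ n` for `n < K`. -/
theorem liuPartial_recurrence {q b c β γ x : ℂ} (hq0 : q ≠ 0) (hb0 : b ≠ 0) (hc0 : c ≠ 0)
    (hqb : ∀ k : ℕ, q / b * q ^ k ≠ 1) (hqc : ∀ k : ℕ, q / c * q ^ k ≠ 1)
    (hβγ : ∀ k : ℕ, β * γ * b * c / q * q ^ k ≠ 1) (hqq : ∀ k : ℕ, q * q ^ k ≠ 1)
    (hx0 : x ≠ 0) (hx1 : x ≠ 1) (hxu : q * x ^ 2 ≠ 1) (hxd : x ^ 2 ≠ q) (K : ℕ) :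
    upCoeff q b c β γ x * (liuPartial q b c β γ K (q * x) - liuPartial q b c β γ K x)
      + downCoeff q b c β γ x * (liuPartial q b c β γ K (x / q) - liuPartial q b c β γ K x)
      + (1 - β) * (1 - γ) * (1 + x) * liuPartial q b c β γ K x
      = (1 + x) * (q ^ K)⁻¹ * (1 - β * q ^ K) * (1 - γ * q ^ K)
        * (liuCoeff q b c β γ K * symPoch q x K) := by
  induction K with
  | zero => simp [liuPartial, liuCoeff, symPoch]; ring
  | succ K ih =>
    have hs : ∀ y, liuPartial q b c β γ (K + 1) y = liuPartial q b c β γ K y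
        + liuCoeff q b c β γ (K + 1) * symPoch q y (K + 1) :=
      fun y => Finset.sum_range_succ _ _
    have hx1' : 1 - x ≠ 0 := sub_ne_zero.mpr hx1.symm
    have hx1'' : x - 1 ≠ 0 := sub_ne_zero.mpr hx1
    have hu : symPoch q (q * x) (K + 1) = symPoch q x K *
        ((1 - (q * x)⁻¹) * (1 - x * q ^ K) * (1 - x * q ^ (K + 1))) / (1 - x) := by
      rw [eq_div_iff hx1', ← symPoch_shift_up hq0 hx0]; ring
    have hd : symPoch q (x / q) (K + 1) = symPoch q x K *
        ((1 - x / q) * (1 - x⁻¹ * q ^ K) * (1 - x⁻¹ * q ^ (K + 1))) / (1 - x⁻¹) := by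
      rw [eq_div_iff, ← symPoch_shift_down hq0 hx0]; · ring
      · rw [sub_ne_zero]; intro h; exact hx1 (inv_eq_one.mp h.symm)
    rw [hs, hs, hs, hu, hd, symPoch_succ, liuCoeff_succ]
    have e1 := sub_ne_zero.mpr (hqb K).symm
    have e2 := sub_ne_zero.mpr (hqc K).symm
    have e3 := sub_ne_zero.mpr (hβγ K).symm
    have e4 := sub_ne_zero.mpr (hqq K).symm
    have e5 := sub_ne_zero.mpr hxu.symm
    have e6 := sub_ne_zero.mpr hxd
    -- The induction step, divided by the `K`-th term, with `Q = q ^ K`.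
    have key : ∀ Q : ℂ, Q ≠ 0 → 1 - q / b * Q ≠ 0 → 1 - q / c * Q ≠ 0 →
        1 - β * γ * b * c / q * Q ≠ 0 → 1 - q * Q ≠ 0 →
        (1 - β * Q) * (1 - γ * Q) * q / ((1 - q / b * Q) * (1 - q / c * Q) *
          (1 - β * γ * b * c / q * Q) * (1 - q * Q)) *
        (upCoeff q b c β γ x * ((1 - (q * x)⁻¹) * (1 - x * Q) * (1 - x * (Q * q)) / (1 - x)
            - (1 - x⁻¹ * Q) * (1 - x * Q))
          + downCoeff q b c β γ x * ((1 - x / q) * (1 - x⁻¹ * Q) * (1 - x⁻¹ * (Q * q)) / (1 - x⁻¹)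
            - (1 - x⁻¹ * Q) * (1 - x * Q))
          + (1 - β) * (1 - γ) * (1 + x) * ((1 - x⁻¹ * Q) * (1 - x * Q))
          - (1 + x) * (Q * q)⁻¹ * (1 - β * (Q * q)) * (1 - γ * (Q * q)) *
             ((1 - x⁻¹ * Q) * (1 - x * Q)))
        = - ((1 + x) * Q⁻¹ * (1 - β * Q) * (1 - γ * Q)) := by
      intro Q hQ e1 e2 e3 e4
      -- The poles of the two coefficients cancel, and the bracket depends on `x` only through the
      -- factor `1 + x`.
      have hbr : (upCoeff q b c β γ x * ((1 - (q * x)⁻¹) * (1 - x * Q) * (1 - x * (Q * q)) / (1 - x)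
            - (1 - x⁻¹ * Q) * (1 - x * Q))
          + downCoeff q b c β γ x * ((1 - x / q) * (1 - x⁻¹ * Q) * (1 - x⁻¹ * (Q * q)) / (1 - x⁻¹)
            - (1 - x⁻¹ * Q) * (1 - x * Q))
          + (1 - β) * (1 - γ) * (1 + x) * ((1 - x⁻¹ * Q) * (1 - x * Q))
          - (1 + x) * (Q * q)⁻¹ * (1 - β * (Q * q)) * (1 - γ * (Q * q)) *
             ((1 - x⁻¹ * Q) * (1 - x * Q)))
          = - ((1 + x) * (Q * q)⁻¹ * ((1 - q / b * Q) * (1 - q / c * Q) *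
          (1 - β * γ * b * c / q * Q) * (1 - q * Q))) := by
        have g1 : (1 - (q * x)⁻¹) * (1 - x * Q) * (1 - x * (Q * q)) / (1 - x)
            - (1 - x⁻¹ * Q) * (1 - x * Q)
            = - (1 - q * Q) * (1 - q * x ^ 2) * (1 - x * Q) / (q * x * (1 - x)) := by
          field_simp; ring
        have g2 : (1 - x / q) * (1 - x⁻¹ * Q) * (1 - x⁻¹ * (Q * q)) / (1 - x⁻¹)
            - (1 - x⁻¹ * Q) * (1 - x * Q)
            = - (1 - q * Q) * (x ^ 2 - q) * (x - Q) / (q * x * (x - 1)) := by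
          field_simp; ring
        rw [g1, g2, upCoeff, downCoeff]
        have g3 : (1 - x * q / b) * (1 - x * q / c) * (1 - β * γ * b * c / q * x)
            / (1 - q * x ^ 2) * (- (1 - q * Q) * (1 - q * x ^ 2) * (1 - x * Q) / (q * x * (1 - x)))
            = - (1 - x * q / b) * (1 - x * q / c) * (1 - β * γ * b * c / q * x)
              * (1 - q * Q) * (1 - x * Q) / (q * x * (1 - x)) := by
          rw [div_mul_div_comm, div_eq_div_iff (mul_ne_zero e5 (mul_ne_zero (mul_ne_zero hq0 hx0) hx1'))
            (mul_ne_zero (mul_ne_zero hq0 hx0) hx1')]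
          ring
        have g4 : (x - q / b) * (x - q / c) * (x - β * γ * b * c / q) / (x ^ 2 - q) *
            (- (1 - q * Q) * (x ^ 2 - q) * (x - Q) / (q * x * (x - 1)))
            = (x - q / b) * (x - q / c) * (x - β * γ * b * c / q) *
              (1 - q * Q) * (x - Q) / (q * x * (1 - x)) := by
          rw [← neg_sub x 1]
          field_simp
        rw [g3, g4]
        field_simp
        ring
      rw [hbr]
      have hD := mul_ne_zero (mul_ne_zero (mul_ne_zero e1 e2) e3) e4
      generalize (1 - q / b * Q) * (1 - q / c * Q) * (1 - β * γ * b * c / q * Q) * (1 - q * Q) = D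
        at hD ⊢
      field_simp
    have k1 := key (q ^ K) (pow_ne_zero _ hq0) e1 e2 e3 e4
    rw [pow_succ]
    linear_combination ih + liuCoeff q b c β γ K * symPoch q x K * k1

/-! ### The recurrence and the growth of `G(n; β, γ)` -/

open Filter Topology in
theorem exists_le_mul_pow_of_eventually_succ_le {f : ℕ → ℝ} {ρ : ℝ} (hρ : 0 < ρ)
    (hf : ∀ n, 0 ≤ f n) (h : ∀ᶠ n in atTop, f (n + 1) ≤ ρ * f n) :
    ∃ C : ℝ, ∀ n, f n ≤ C * ρ ^ n := by
  obtain ⟨N, hN⟩ := eventually_atTop.mp h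
  have hs : ∀ i ≤ N, f i ≤ (∑ j ∈ Finset.range (N + 1), f j / ρ ^ j) * ρ ^ i := by
    intro i hi
    rw [← div_le_iff₀ (pow_pos hρ i)]
    exact Finset.single_le_sum (f := fun j => f j / ρ ^ j)
      (fun j _ => div_nonneg (hf j) (pow_pos hρ j).le) (Finset.mem_range.mpr (by omega))
  refine ⟨∑ j ∈ Finset.range (N + 1), f j / ρ ^ j, fun n => ?_⟩
  induction n with
  | zero => exact hs 0 (Nat.zero_le N)
  | succ n ih =>
    rcases Nat.lt_or_ge n N with hn | hn
    · exact hs (n + 1) hn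
    · calc f (n + 1) ≤ ρ * f n := hN n hn
        _ ≤ ρ * ((∑ j ∈ Finset.range (N + 1), f j / ρ ^ j) * ρ ^ n) :=
          mul_le_mul_of_nonneg_left ih hρ.le
        _ = _ := by rw [pow_succ]; ring

open Filter Topology in
/-- Growth of the solutions of a three-term recurrence whose limiting characteristic polynomial is
`(t - β) (t - γ)`: up to a constant they are bounded by `ρ ^ n` for every `ρ` larger than both
`‖β‖` and `‖γ‖`. -/
theorem exists_norm_le_mul_pow_of_recurrence {g P Q : ℕ → ℂ} {β γ : ℂ} {ρ : ℝ}
    (hβ : ‖β‖ < ρ) (hγ : ‖γ‖ < ρ) (hP : Tendsto P atTop (𝓝 (β + γ)))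
    (hQ : Tendsto Q atTop (𝓝 (β * γ)))
    (h : ∀ᶠ n in atTop, g (n + 2) = P n * g (n + 1) - Q n * g n) :
    ∃ C : ℝ, ∀ n, ‖g n‖ ≤ C * ρ ^ n := by
  have hρ : 0 < ρ := (norm_nonneg β).trans_lt hβ
  -- The limiting system for `(g (n + 1) - β g n, g n)` is triangular with diagonal entries `γ, β`;
  -- the weight `η` makes its off-diagonal entry small.
  set η : ℝ := (ρ - ‖γ‖) / 2 with hη
  have hη0 : 0 < η := by rw [hη]; linarith
  have hp : Tendsto (fun n => ‖P n - (β + γ)‖) atTop (𝓝 0) := by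
    simpa using (hP.sub_const (β + γ)).norm
  have hr : Tendsto (fun n => ‖β * γ - Q n‖) atTop (𝓝 0) := by
    simpa using (hQ.const_sub (β * γ)).norm
  have hpr : Tendsto (fun n => ‖P n - (β + γ)‖ * ‖β‖ + ‖β * γ - Q n‖) atTop (𝓝 0) := by
    simpa using (hp.mul_const ‖β‖).add hr
  have hpos : 0 < η * (ρ - ‖β‖) := mul_pos hη0 (by linarith)
  obtain ⟨C, hC⟩ := exists_le_mul_pow_of_eventually_succ_le (ρ := ρ)
    (f := fun n => ‖g (n + 1) - β * g n‖ + η * ‖g n‖) hρ (fun n => by positivity) (by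
      filter_upwards [h, hp.eventually (gt_mem_nhds hη0), hpr.eventually (gt_mem_nhds hpos)]
        with n hn h1 h2
      set u := g (n + 1) - β * g n with hu
      have hg1 : g (n + 1) = β * g n + u := by rw [hu]; ring
      have hu1 : g (n + 1 + 1) - β * g (n + 1)
          = γ * u + (P n - (β + γ)) * g (n + 1) + (β * γ - Q n) * g n := by
        rw [hn, hu]; ring
      have n1 : ‖g (n + 1)‖ ≤ ‖β‖ * ‖g n‖ + ‖u‖ := by
        rw [hg1]; exact (norm_add_le _ _).trans (by rw [norm_mul])
      have n2 : ‖g (n + 1 + 1) - β * g (n + 1)‖ ≤ ‖γ‖ * ‖u‖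
          + ‖P n - (β + γ)‖ * ‖g (n + 1)‖ + ‖β * γ - Q n‖ * ‖g n‖ := by
        rw [hu1]
        refine (norm_add₃_le).trans ?_
        simp only [norm_mul, le_refl]
      have n3 := mul_le_mul_of_nonneg_left n1 (norm_nonneg (P n - (β + γ)))
      have n4 := mul_le_mul_of_nonneg_left n1 hη0.le
      have n5 := mul_le_mul_of_nonneg_right h1.le (norm_nonneg u)
      have n6 := mul_le_mul_of_nonneg_right h2.le (norm_nonneg (g n))
      have n7 : ‖γ‖ * ‖u‖ + 2 * η * ‖u‖ = ρ * ‖u‖ := by rw [hη]; ring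
      nlinarith [n2, n3, n4, n5, n6, n7])
  refine ⟨C / η, fun n => ?_⟩
  rw [div_mul_eq_mul_div, le_div_iff₀ hη0]
  have := hC n
  have := norm_nonneg (g (n + 1) - β * g n)
  linarith

theorem liuG_neg (q b c β γ : ℂ) (n : ℤ) : liuG q b c β γ (-n) = liuG q b c β γ n := by
  have h : ∀ k : ℤ, qPochs [q ^ (- -n), q ^ (-n), β, γ] q k
      = qPochs [q ^ (-n), q ^ n, β, γ] q k := by
    intro k
    simp only [qPochs, List.map_cons, List.prod_cons, neg_neg]
    ring
  simp only [liuG, basicHyp, h, List.length_cons, List.length_nil]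

theorem liuG_natCast_eq_liuPartial {q : ℂ} (hq0 : q ≠ 0) (b c β γ : ℂ) {n K : ℕ} (h : n ≤ K) :
    liuG q b c β γ n = liuPartial q b c β γ K (q ^ n) := by
  have ht : liuG q b c β γ n
      = ∑' k : ℕ, liuCoeff q b c β γ k * symPoch q (q ^ n) k := by
    rw [liuG, basicHyp]
    refine tsum_congr fun k => ?_
    simp only [qPochs, List.map_cons, List.map_nil, List.prod_cons, List.prod_nil,
      List.length_cons, List.length_nil, qPoch_natCast, liuCoeff, symPoch,
      Finset.prod_mul_distrib, Finset.prod_div_distrib, Finset.prod_const, Finset.card_range,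
      zpow_neg, zpow_natCast]
    norm_num
    ring
  rw [ht, liuPartial]
  refine tsum_eq_sum fun k hk => ?_
  rw [symPoch_pow_eq_zero hq0 (by simp at hk; omega), mul_zero]

theorem pow_ne_one_of_norm_lt_one {q : ℂ} (hq : ‖q‖ < 1) {n : ℕ} (hn : n ≠ 0) : q ^ n ≠ 1 := by
  intro h
  have := pow_lt_one₀ (norm_nonneg q) hq hn
  rw [← norm_pow, h, norm_one] at this
  exact this.false

/-- The three-term recurrence of the Askey–Wilson polynomials, for the parameters occurring in
`G(n; β, γ)`. -/
theorem liuG_recurrence {q b c β γ : ℂ} (hq0 : q ≠ 0) (hq : ‖q‖ < 1) (hb0 : b ≠ 0) (hc0 : c ≠ 0)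
    (hqb : ∀ k : ℕ, q / b * q ^ k ≠ 1) (hqc : ∀ k : ℕ, q / c * q ^ k ≠ 1)
    (hβγ : ∀ k : ℕ, β * γ * b * c / q * q ^ k ≠ 1) (n : ℕ) :
    upCoeff q b c β γ (q ^ (n + 1)) *
        (liuG q b c β γ (n + 2 : ℕ) - liuG q b c β γ (n + 1 : ℕ))
      + downCoeff q b c β γ (q ^ (n + 1)) *
        (liuG q b c β γ n - liuG q b c β γ (n + 1 : ℕ))
      + (1 - β) * (1 - γ) * (1 + q ^ (n + 1)) * liuG q b c β γ (n + 1 : ℕ) = 0 := by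
  have hxd : (q ^ (n + 1)) ^ 2 ≠ q := by
    intro h
    refine pow_ne_one_of_norm_lt_one hq (n := 2 * n + 1) (by omega)
      (mul_right_cancel₀ hq0 ?_)
    rw [one_mul]
    nth_rw 3 [← h]
    ring
  have hxu : q * (q ^ (n + 1)) ^ 2 ≠ 1 := by
    have := pow_ne_one_of_norm_lt_one hq (n := 2 * n + 3) (by omega)
    intro h
    apply this
    rw [← h]
    ring
  have hqq : ∀ k : ℕ, q * q ^ k ≠ 1 := fun k => by
    rw [← pow_succ']; exact pow_ne_one_of_norm_lt_one hq (by omega)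
  have h := liuPartial_recurrence hq0 hb0 hc0 hqb hqc hβγ hqq (pow_ne_zero (n + 1) hq0)
    (pow_ne_one_of_norm_lt_one hq (by omega)) hxu hxd (n + 2)
  have e1 : q * q ^ (n + 1) = q ^ (n + 2) := by ring
  have e2 : q ^ (n + 1) / q = q ^ n := by rw [pow_succ, mul_div_cancel_right₀ _ hq0]
  rw [e1, e2, symPoch_pow_eq_zero hq0 (by omega : n + 1 < n + 2), mul_zero, mul_zero,
    ← liuG_natCast_eq_liuPartial hq0 _ _ _ _ le_rfl,
    ← liuG_natCast_eq_liuPartial hq0 _ _ _ _ (by omega),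
    ← liuG_natCast_eq_liuPartial hq0 _ _ _ _ (by omega)] at h
  exact h

theorem liuG_zero {q : ℂ} (hq0 : q ≠ 0) (b c β γ : ℂ) : liuG q b c β γ (0 : ℕ) = 1 := by
  rw [liuG_natCast_eq_liuPartial hq0 _ _ _ _ le_rfl]
  simp [liuPartial, liuCoeff, symPoch]

theorem liuG_one {q : ℂ} (hq0 : q ≠ 0) (b c β γ : ℂ) :
    liuG q b c β γ (1 : ℕ) = 1 + (1 - β) * (1 - γ) * q /
      ((1 - q / b) * (1 - q / c) * (1 - β * γ * b * c / q) * (1 - q)) * ((1 - q⁻¹) * (1 - q)) := by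
  rw [liuG_natCast_eq_liuPartial hq0 _ _ _ _ le_rfl]
  simp [liuPartial, liuCoeff, symPoch, Finset.sum_range_succ]

open Filter Topology in
theorem tendsto_upCoeff (b c β γ : ℂ) {q : ℂ} (hq : ‖q‖ < 1) :
    Tendsto (fun n : ℕ => upCoeff q b c β γ (q ^ n)) atTop (𝓝 1) := by
  have : ContinuousAt (upCoeff q b c β γ) 0 := by
    unfold upCoeff
    exact ContinuousAt.div (by fun_prop) (by fun_prop) (by simp)
  have h := this.tendsto.comp (tendsto_pow_atTop_nhds_zero_of_norm_lt_one hq)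
  have e : upCoeff q b c β γ 0 = 1 := by simp [upCoeff]
  rwa [e] at h

open Filter Topology in
theorem tendsto_downCoeff (β γ : ℂ) {q b c : ℂ} (hq0 : q ≠ 0) (hq : ‖q‖ < 1) (hb0 : b ≠ 0)
    (hc0 : c ≠ 0) : Tendsto (fun n : ℕ => downCoeff q b c β γ (q ^ n)) atTop (𝓝 (β * γ)) := by
  have : ContinuousAt (downCoeff q b c β γ) 0 := by
    unfold downCoeff
    exact ContinuousAt.div (by fun_prop) (by fun_prop) (by simpa using hq0)
  have h := this.tendsto.comp (tendsto_pow_atTop_nhds_zero_of_norm_lt_one hq)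
  have e : downCoeff q b c β γ 0 = β * γ := by
    rw [downCoeff, zero_sub, zero_sub, zero_sub, zero_pow two_ne_zero, zero_sub]
    field_simp
  rwa [e] at h

open Filter Topology in
theorem exists_norm_liuG_le {q b c β γ : ℂ} (hq0 : q ≠ 0) (hq : ‖q‖ < 1) (hb0 : b ≠ 0)
    (hc0 : c ≠ 0) (hqb : ∀ k : ℕ, q / b * q ^ k ≠ 1) (hqc : ∀ k : ℕ, q / c * q ^ k ≠ 1)
    (hβγ : ∀ k : ℕ, β * γ * b * c / q * q ^ k ≠ 1) {ρ : ℝ} (hβ : ‖β‖ < ρ) (hγ : ‖γ‖ < ρ) :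
    ∃ C : ℝ, ∀ n : ℕ, ‖liuG q b c β γ n‖ ≤ C * ρ ^ n := by
  have hx : Tendsto (fun n : ℕ => q ^ (n + 1)) atTop (𝓝 0) :=
    (tendsto_pow_atTop_nhds_zero_of_norm_lt_one hq).comp (tendsto_add_atTop_nat 1)
  have hA := (tendsto_upCoeff b c β γ hq).comp (tendsto_add_atTop_nat 1)
  have hC := (tendsto_downCoeff β γ hq0 hq hb0 hc0).comp (tendsto_add_atTop_nat 1)
  refine exists_norm_le_mul_pow_of_recurrence (g := fun n : ℕ => liuG q b c β γ n)
    (P := fun n => (upCoeff q b c β γ (q ^ (n + 1)) + downCoeff q b c β γ (q ^ (n + 1))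
      - (1 - β) * (1 - γ) * (1 + q ^ (n + 1))) / upCoeff q b c β γ (q ^ (n + 1)))
    (Q := fun n => downCoeff q b c β γ (q ^ (n + 1)) / upCoeff q b c β γ (q ^ (n + 1)))
    hβ hγ ?_ ?_ ?_
  · have h := ((hA.add hC).sub ((hx.const_add 1).const_mul ((1 - β) * (1 - γ)))).div hA one_ne_zero
    have e : (1 + β * γ - (1 - β) * (1 - γ) * (1 + 0)) / 1 = β + γ := by ring
    rwa [e] at h
  · have h := hC.div hA one_ne_zero
    rwa [div_one] at h
  · filter_upwards [hA.eventually_ne one_ne_zero] with n hn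
    replace hn : upCoeff q b c β γ (q ^ (n + 1)) ≠ 0 := hn
    have h := liuG_recurrence hq0 hq hb0 hc0 hqb hqc hβγ n
    rw [div_mul_eq_mul_div, div_mul_eq_mul_div, ← sub_div, eq_div_iff hn]
    linear_combination h

/-! ### The weights and their contiguity in `d` -/

/-- The factor of the quotient of consecutive weights that does not involve `d`, at `y = q ^ n`. -/
noncomputable def liuRatio (q b c y : ℂ) : ℂ :=
  (1 - q * y / b) * (1 - q * y / c) * (b * c / q ^ 2) / ((1 - b * y) * (1 - c * y))

/-- The weight `(q/b, q/c, q/d; q)_n (bcd/q²)^n / (b, c, d; q)_n` of `G(n; β, γ)` for `n ≥ 0`, written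
so that it also makes sense at `d = 0`. -/
noncomputable def liuWeight (q b c d : ℂ) (n : ℕ) : ℂ :=
  ∏ i ∈ Finset.range n, (liuRatio q b c (q ^ i) * ((d - q * q ^ i) / (1 - d * q ^ i)))

/-- The sum of the `n`-th and the `-n`-th term of the bilateral series for `n ≥ 1`, and its
`0`-th term for `n = 0`. -/
noncomputable def foldedTerm (q b c β γ d : ℂ) (n : ℕ) : ℂ :=
  (if n = 0 then 1 else 1 + q ^ n) * (liuWeight q b c d n * liuG q b c β γ n)

/-- The flux whose differences are the terms of the contiguous relation between `d` and `d q`. -/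
noncomputable def liuFlux (q b c β γ d : ℂ) (n : ℕ) : ℂ :=
  upCoeff q b c β γ (q ^ n) * (liuWeight q b c d n * liuG q b c β γ (n + 1 : ℕ))
    - downCoeff q b c β γ (q ^ (n + 1)) * (liuWeight q b c d (n + 1) * liuG q b c β γ n)

theorem liuWeight_succ (q b c d : ℂ) (n : ℕ) :
    liuWeight q b c d (n + 1) = liuWeight q b c d n *
      (liuRatio q b c (q ^ n) * ((d - q * q ^ n) / (1 - d * q ^ n))) :=
  Finset.prod_range_succ _ _

theorem liuWeight_shift {q d : ℂ} (b c : ℂ) (hd : ∀ k : ℕ, d * q ^ k ≠ 1) (n : ℕ) :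
    liuWeight q b c (d * q) (n + 1) = liuWeight q b c d n * (liuRatio q b c (q ^ n) *
      (q * q ^ n * (d - 1) * (1 - d) / ((1 - d * q ^ n) * (1 - d * q * q ^ n)))) := by
  induction n with
  | zero =>
    have h0 : 1 - d ≠ 0 := by simpa using sub_ne_zero.mpr (hd 0).symm
    have e : q * (d - 1) * (1 - d) / ((1 - d) * (1 - d * q)) = (d * q - q) / (1 - d * q) := by
      rw [mul_comm (1 - d), mul_div_mul_right _ _ h0]
      ring
    simp [liuWeight, e]
  | succ n ih =>
    have h1 := sub_ne_zero.mpr (hd n).symm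
    have h2 := sub_ne_zero.mpr (hd (n + 1)).symm
    have h3 := sub_ne_zero.mpr (hd (n + 2)).symm
    have e2 : 1 - d * q * q ^ n = 1 - d * q ^ (n + 1) := by ring
    have e3 : 1 - d * q * q ^ (n + 1) = 1 - d * q ^ (n + 2) := by ring
    rw [liuWeight_succ, ih, liuWeight_succ, e2, e3]
    generalize hu : 1 - d * q ^ n = u at h1
    generalize hv : 1 - d * q ^ (n + 1) = v at h2
    generalize hw : 1 - d * q ^ (n + 2) = w at h3
    field_simp
    ring

theorem liuWeight_mul_q {q d : ℂ} (b c : ℂ) (hd : ∀ k : ℕ, d * q ^ k ≠ 1) (n : ℕ) :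
    (d - q ^ n) * (1 - d * q ^ n) * liuWeight q b c (d * q) n
      = q ^ n * (d - 1) * (1 - d) * liuWeight q b c d n := by
  cases n with
  | zero => simp [liuWeight]
  | succ n =>
    have h1 := sub_ne_zero.mpr (hd n).symm
    have h2 := sub_ne_zero.mpr (hd (n + 1)).symm
    have e2 : 1 - d * q * q ^ n = 1 - d * q ^ (n + 1) := by ring
    rw [liuWeight_shift b c hd, liuWeight_succ, e2]
    generalize hu : 1 - d * q ^ n = u at h1
    generalize hv : 1 - d * q ^ (n + 1) = v at h2
    field_simp
    ring

/-- The coefficient identity behind the contiguous relation: the adjoint of the recurrence operator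
maps the weight for `d` to a combination of the weights for `d` and `d q`. -/
theorem weight_adjoint_identity {q b c d β γ y : ℂ} (hq0 : q ≠ 0) (hb0 : b ≠ 0) (hc0 : c ≠ 0)
    (hby : b * y ≠ 1) (hcy : c * y ≠ 1) (hdy : d * y ≠ 1) (hbx : b * (q * y) ≠ 1)
    (hcx : c * (q * y) ≠ 1) (hdx : d * (q * y) ≠ 1) (hx : q * (q * y) ^ 2 ≠ 1)
    (hy : q * y ^ 2 ≠ 1) :
    (1 + q * y) * ((1 - d) * (1 - b * c * d / q ^ 2) * (1 - β * γ * b * c / q * d / q))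
        * (liuRatio q b c y * ((d - q * y) / (1 - d * y)))
      - (1 + q * y) * ((1 - b * d / q) * (1 - c * d / q) * (1 - β * γ * b * c / q * d / q))
        * (liuRatio q b c y * (q * y * (d - 1) * (1 - d) / ((1 - d * y) * (1 - d * (q * y)))))
      + (1 - d) * (b * c * d / q ^ 2) * (liuRatio q b c y * ((d - q * y) / (1 - d * y)))
        * (upCoeff q b c β γ (q * y) + downCoeff q b c β γ (q * y))
    = (1 - d) * (b * c * d / q ^ 2) * (upCoeff q b c β γ y
      + downCoeff q b c β γ (q * (q * y)) * (liuRatio q b c y * ((d - q * y) / (1 - d * y)) *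
          (liuRatio q b c (q * y) * ((d - q * (q * y)) / (1 - d * (q * y)))))) := by
  have h1 := sub_ne_zero.mpr hby.symm
  have h2 := sub_ne_zero.mpr hcy.symm
  have h3 := sub_ne_zero.mpr hdy.symm
  have h4 := sub_ne_zero.mpr hbx.symm
  have h5 := sub_ne_zero.mpr hcx.symm
  have h6 := sub_ne_zero.mpr hdx.symm
  have h7 := sub_ne_zero.mpr hx.symm
  have h8 := sub_ne_zero.mpr hy.symm
  generalize hδ : β * γ * b * c / q = δ
  have a1 : upCoeff q b c β γ y = liuRatio q b c y *
      ((1 - δ * y) * (1 - b * y) * (1 - c * y) * q ^ 2 / (b * c) / (1 - q * y ^ 2)) := by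
    rw [upCoeff, hδ, liuRatio]
    generalize 1 - q * y ^ 2 = u at h8 ⊢
    generalize 1 - b * y = v at h1 ⊢
    generalize 1 - c * y = w at h2 ⊢
    field_simp
  have a2 : downCoeff q b c β γ (q * (q * y)) * liuRatio q b c (q * y) =
      - ((q * (q * y) - δ) * (1 - q * (q * y) / b) * (1 - q * (q * y) / c)
        / (q * (1 - q * (q * y) ^ 2))) := by
    have e1 : q * (q * y) - q / b = - (q / b) * (1 - b * (q * y)) := by field_simp; ring
    have e2 : q * (q * y) - q / c = - (q / c) * (1 - c * (q * y)) := by field_simp; ring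
    have e3 : (q * (q * y)) ^ 2 - q = - q * (1 - q * (q * y) ^ 2) := by ring
    rw [downCoeff, hδ, liuRatio, e1, e2, e3]
    generalize 1 - q * (q * y) ^ 2 = u at h7 ⊢
    generalize 1 - b * (q * y) = v at h4 ⊢
    generalize 1 - c * (q * y) = w at h5 ⊢
    field_simp
  have a3 : upCoeff q b c β γ (q * y) = (1 - q * y * q / b) * (1 - q * y * q / c)
      * (1 - δ * (q * y)) / (1 - q * (q * y) ^ 2) := by rw [upCoeff, hδ]
  have a4 : downCoeff q b c β γ (q * y) = - ((q * y - q / b) * (q * y - q / c)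
      * (q * y - δ) / (q * (1 - q * y ^ 2))) := by
    rw [downCoeff, hδ, ← div_neg]
    congr 1
    ring
  -- The identity divided by `liuRatio q b c y`, with the factors that cancel removed.
  have key : (1 + q * y) * ((1 - d) * (1 - b * c * d / q ^ 2) * (1 - δ * d / q))
        * ((d - q * y) / (1 - d * y))
      - (1 + q * y) * ((1 - b * d / q) * (1 - c * d / q) * (1 - δ * d / q))
        * (q * y * (d - 1) * (1 - d) / ((1 - d * y) * (1 - d * (q * y))))
      + (1 - d) * (b * c * d / q ^ 2) * ((d - q * y) / (1 - d * y))
        * ((1 - q * y * q / b) * (1 - q * y * q / c)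
      * (1 - δ * (q * y)) / (1 - q * (q * y) ^ 2) - ((q * y - q / b) * (q * y - q / c)
      * (q * y - δ) / (q * (1 - q * y ^ 2))))
    = (1 - d) * (b * c * d / q ^ 2) *
      ((1 - δ * y) * (1 - b * y) * (1 - c * y) * q ^ 2 / (b * c) / (1 - q * y ^ 2)
      - ((q * (q * y) - δ) * (1 - q * (q * y) / b) * (1 - q * (q * y) / c)
        / (q * (1 - q * (q * y) ^ 2))) * ((d - q * y) / (1 - d * y) *
          ((d - q * (q * y)) / (1 - d * (q * y))))) := by
    clear a1 a2 a3 a4 hδ hby hcy hdy hbx hcx hdx hx hy h1 h2 h4 h5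
    generalize hu : 1 - d * y = u at h3 ⊢
    generalize hv : 1 - d * (q * y) = v at h6 ⊢
    generalize hw : 1 - q * (q * y) ^ 2 = w at h7 ⊢
    generalize hz : 1 - q * y ^ 2 = z at h8 ⊢
    field_simp
    rw [← hu, ← hv, ← hw, ← hz]
    ring
  rw [a1, a3, a4]
  linear_combination liuRatio q b c y * key - (1 - d) * (b * c * d / q ^ 2) *
    (liuRatio q b c y * ((d - q * y) / (1 - d * y)) *
          (((d - q * (q * y)) / (1 - d * (q * y))))) * a2

/-! ### The contiguous relation for the sum -/

/-- The conditions on `q, b, c, β, γ` under which all the factors `(b, c, q/b, q/c, βγbc/q; q)_n` are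
defined and do not vanish. -/
structure LiuAdmissible (q b c β γ : ℂ) : Prop where
  q_ne_zero : q ≠ 0
  norm_q : ‖q‖ < 1
  b_ne_zero : b ≠ 0
  c_ne_zero : c ≠ 0
  b_pow : ∀ k : ℕ, b * q ^ k ≠ 1
  c_pow : ∀ k : ℕ, c * q ^ k ≠ 1
  qb_pow : ∀ k : ℕ, q / b * q ^ k ≠ 1
  qc_pow : ∀ k : ℕ, q / c * q ^ k ≠ 1
  βγ_pow : ∀ k : ℕ, β * γ * b * c / q * q ^ k ≠ 1

/-- The partial sums of the contiguous relation telescope. -/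
theorem sum_foldedTerm_contiguous {q b c β γ d : ℂ} (h : LiuAdmissible q b c β γ)
    (hd : ∀ k : ℕ, d * q ^ k ≠ 1) (N : ℕ) :
    ∑ n ∈ Finset.range (N + 1),
      ((1 - d) * (1 - β * b * c * d / q ^ 2) * (1 - γ * b * c * d / q ^ 2)
          * foldedTerm q b c β γ d n
        - (1 - b * d / q) * (1 - c * d / q) * (1 - β * γ * b * c * d / q ^ 2)
          * foldedTerm q b c β γ (d * q) n)
      = - ((1 - d) * (b * c * d / q ^ 2) * liuFlux q b c β γ d N) := by
  obtain ⟨hq0, hq, hb0, hc0, hb, hc, hqb, hqc, hβγ⟩ := h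
  induction N with
  | zero =>
    have e1 := sub_ne_zero.mpr (hqb 0).symm
    have e2 := sub_ne_zero.mpr (hqc 0).symm
    have e3 := sub_ne_zero.mpr (hβγ 0).symm
    have e4 := sub_ne_zero.mpr (hb 0).symm
    have e5 := sub_ne_zero.mpr (hc 0).symm
    have e6 := sub_ne_zero.mpr (hd 0).symm
    have e7 := sub_ne_zero.mpr (pow_ne_one_of_norm_lt_one hq one_ne_zero).symm
    simp only [pow_zero, mul_one, pow_one] at e1 e2 e3 e4 e5 e6 e7
    rw [Finset.sum_range_one, liuFlux, zero_add, liuG_one hq0, foldedTerm, foldedTerm,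
      liuG_zero hq0]
    have w0 : ∀ d, liuWeight q b c d 0 = 1 := fun d => rfl
    rw [liuWeight_succ, w0, w0, pow_zero, pow_one, if_pos rfl]
    have a1 : upCoeff q b c β γ 1 * ((1 - β) * (1 - γ) * q /
      ((1 - q / b) * (1 - q / c) * (1 - β * γ * b * c / q) * (1 - q)) * ((1 - q⁻¹) * (1 - q)))
        = - ((1 - β) * (1 - γ)) := by
      rw [upCoeff]
      simp only [one_mul, mul_one, one_pow]
      generalize 1 - q / b = u at e1 ⊢
      generalize 1 - q / c = v at e2 ⊢
      generalize 1 - β * γ * b * c / q = w at e3 ⊢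
      field_simp
      ring
    have a2 : downCoeff q b c β γ q * liuRatio q b c 1
        = - ((q - β * γ * b * c / q) * (1 - q / b) * (1 - q / c) / (q * (1 - q))) := by
      have g1 : q - q / b = - (q / b) * (1 - b) := by field_simp; ring
      have g2 : q - q / c = - (q / c) * (1 - c) := by field_simp; ring
      have g3 : q ^ 2 - q = - (q * (1 - q)) := by ring
      rw [downCoeff, liuRatio, g1, g2, g3]
      simp only [mul_one]
      generalize 1 - q / b = u at e1 ⊢
      generalize 1 - q / c = v at e2 ⊢
      field_simp
    have a3 : upCoeff q b c β γ 1
        = (1 - q / b) * (1 - q / c) * (1 - β * γ * b * c / q) / (1 - q) := by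
      rw [upCoeff]; simp only [one_mul, mul_one, one_pow]
    have key : (1 - d) * (1 - β * b * c * d / q ^ 2) * (1 - γ * b * c * d / q ^ 2)
        - (1 - b * d / q) * (1 - c * d / q) * (1 - β * γ * b * c * d / q ^ 2)
        = - ((1 - d) * (b * c * d / q ^ 2) *
          ((1 - q / b) * (1 - q / c) * (1 - β * γ * b * c / q) / (1 - q) - (1 - β) * (1 - γ)
          + (q - β * γ * b * c / q) * (1 - q / b) * (1 - q / c) / (q * (1 - q))
            * ((d - q) / (1 - d)))) := by
      clear a1 a2 a3 e1 e2 e3 e4 e5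
      field_simp
      ring
    simp only [mul_one, one_mul]
    linear_combination key + (1 - d) * (b * c * d / q ^ 2) * (a1 + a3 - a2 * ((d - q) / (1 - d)))
  | succ n ih =>
    rw [Finset.sum_range_succ, ih]
    have hx : q * (q * q ^ n) ^ 2 ≠ 1 := by
      have := pow_ne_one_of_norm_lt_one hq (n := 2 * n + 3) (by omega)
      intro h; apply this; rw [← h]; ring
    have hy : q * (q ^ n) ^ 2 ≠ 1 := by
      have := pow_ne_one_of_norm_lt_one hq (n := 2 * n + 1) (by omega)
      intro h; apply this; rw [← h]; ring
    have key := weight_adjoint_identity (β := β) (γ := γ) hq0 hb0 hc0 (hb n) (hc n) (hd n)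
      (by rw [← pow_succ']; exact hb _) (by rw [← pow_succ']; exact hc _)
      (by rw [← pow_succ']; exact hd _) hx hy
    have hrec := liuG_recurrence hq0 hq hb0 hc0 hqb hqc hβγ n
    have e1 : d * q * q ^ n = d * q ^ (n + 1) := by ring
    rw [← pow_succ', ← pow_succ'] at key
    rw [foldedTerm, foldedTerm, if_neg (Nat.succ_ne_zero n), liuWeight_shift b c hd, liuFlux,
      liuFlux, liuWeight_succ q b c d (n + 1), liuWeight_succ q b c d n, e1, ← pow_succ']
    linear_combination liuWeight q b c d n * liuG q b c β γ (n + 1 : ℕ) * key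
      + (1 - d) * (b * c * d / q ^ 2) * (liuWeight q b c d n
        * (liuRatio q b c (q ^ n) * ((d - q ^ (n + 1)) / (1 - d * q ^ n)))) * hrec

open Filter Topology in
theorem tendsto_weight_ratio {q b c : ℂ} (d : ℂ) (hq : ‖q‖ < 1) :
    Tendsto (fun n : ℕ => liuRatio q b c (q ^ n) * ((d - q * q ^ n) / (1 - d * q ^ n))) atTop
      (𝓝 (b * c * d / q ^ 2)) := by
  have : ContinuousAt (fun y => liuRatio q b c y * ((d - q * y) / (1 - d * y))) 0 := by
    unfold liuRatio
    exact ContinuousAt.mul (ContinuousAt.div (by fun_prop) (by fun_prop) (by simp))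
      (ContinuousAt.div (by fun_prop) (by fun_prop) (by simp))
  have h := this.tendsto.comp (tendsto_pow_atTop_nhds_zero_of_norm_lt_one hq)
  have e : liuRatio q b c 0 * ((d - q * 0) / (1 - d * 0)) = b * c * d / q ^ 2 := by
    simp [liuRatio]; ring
  rwa [e] at h

open Filter Topology in
/-- The flux involves the products `w_n G(n + 1)` and `w_{n+1} G(n)`; they tend to `0` with the terms
`w_n G(n)` because the quotient of consecutive weights tends to `bcd/q²`, which is not `0`. -/
theorem tendsto_liuFlux {q b c β γ d : ℂ} (h : LiuAdmissible q b c β γ) (hd0 : d ≠ 0)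
    (hs : Summable (foldedTerm q b c β γ d)) :
    Tendsto (liuFlux q b c β γ d) atTop (𝓝 0) := by
  have hX : b * c * d / q ^ 2 ≠ 0 := div_ne_zero
    (mul_ne_zero (mul_ne_zero h.b_ne_zero h.c_ne_zero) hd0) (pow_ne_zero _ h.q_ne_zero)
  have hτ := tendsto_weight_ratio (b := b) (c := c) d h.norm_q
  have hx : Tendsto (fun n : ℕ => 1 + q ^ n) atTop (𝓝 1) := by
    simpa using (tendsto_pow_atTop_nhds_zero_of_norm_lt_one h.norm_q).const_add 1
  have hT : Tendsto (fun n : ℕ => liuWeight q b c d n * liuG q b c β γ n) atTop (𝓝 0) := by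
    have h1 := hs.tendsto_atTop_zero.div hx one_ne_zero
    rw [zero_div] at h1
    refine h1.congr' ?_
    filter_upwards [hx.eventually_ne one_ne_zero, eventually_ne_atTop 0] with n hn hn0
    simp only [Pi.div_apply, foldedTerm, if_neg hn0]
    rw [mul_div_cancel_left₀ _ hn]
  have hU : Tendsto (fun n : ℕ => liuWeight q b c d n * liuG q b c β γ (n + 1 : ℕ)) atTop
      (𝓝 0) := by
    have h1 := (hT.comp (tendsto_add_atTop_nat 1)).div hτ hX
    rw [zero_div] at h1
    refine h1.congr' ?_
    filter_upwards [hτ.eventually_ne hX] with n hn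
    simp only [Pi.div_apply, Function.comp, liuWeight_succ]
    rw [mul_right_comm, mul_div_cancel_right₀ _ hn]
  have hD : Tendsto (fun n : ℕ => liuWeight q b c d (n + 1) * liuG q b c β γ n) atTop
      (𝓝 0) := by
    have h1 := hT.mul hτ
    rw [zero_mul] at h1
    refine h1.congr fun n => ?_
    rw [liuWeight_succ]
    ring
  have hA := tendsto_upCoeff b c β γ h.norm_q
  have hC := (tendsto_downCoeff β γ h.q_ne_zero h.norm_q h.b_ne_zero h.c_ne_zero).comp
    (tendsto_add_atTop_nat 1)
  have h1 := (hA.mul hU).sub (hC.mul hD)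
  rw [mul_zero, mul_zero, sub_zero] at h1
  exact h1

open Filter Topology in
/-- If `d = q ^ j`, the relation between the weights for `d` and `d q` degenerates at `n = j`; it is
used only for large `n`. -/
theorem Summable.foldedTerm_mul_q {q b c β γ d : ℂ} (h : LiuAdmissible q b c β γ) (hd0 : d ≠ 0)
    (hd : ∀ k : ℕ, d * q ^ k ≠ 1) (hs : Summable (foldedTerm q b c β γ d)) :
    Summable (foldedTerm q b c β γ (d * q)) := by
  have hx := tendsto_pow_atTop_nhds_zero_of_norm_lt_one h.norm_q
  have hden : Tendsto (fun n : ℕ => (d - q ^ n) * (1 - d * q ^ n)) atTop (𝓝 d) := by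
    simpa using (hx.const_sub d).mul ((hx.const_mul d).const_sub 1)
  have hr : Tendsto (fun n : ℕ => q ^ n * (d - 1) * (1 - d) / ((d - q ^ n) * (1 - d * q ^ n)))
      atTop (𝓝 0) := by
    have := ((hx.mul_const (d - 1)).mul_const (1 - d)).div hden hd0
    rwa [zero_mul, zero_mul, zero_div] at this
  refine summable_of_isBigO_nat hs.norm (Asymptotics.IsBigO.of_bound 1 ?_)
  filter_upwards [hden.eventually_ne hd0, 
    (tendsto_zero_iff_norm_tendsto_zero.mp hr).eventually_le_const one_pos] with n hn h1
  have hw : liuWeight q b c (d * q) n = q ^ n * (d - 1) * (1 - d) /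
      ((d - q ^ n) * (1 - d * q ^ n)) * liuWeight q b c d n := by
    rw [div_mul_eq_mul_div, eq_div_iff hn, ← liuWeight_mul_q b c hd]
    ring
  have e : foldedTerm q b c β γ (d * q) n = q ^ n * (d - 1) * (1 - d) /
      ((d - q ^ n) * (1 - d * q ^ n)) * foldedTerm q b c β γ d n := by
    rw [foldedTerm, hw, foldedTerm]; ring
  rw [e, norm_mul, norm_norm]
  exact mul_le_mul_of_nonneg_right h1 (norm_nonneg _)

open Filter Topology in
/-- The contiguous relation between the sums for `d` and `d q`. -/
theorem tsum_foldedTerm_contiguous {q b c β γ d : ℂ} (h : LiuAdmissible q b c β γ) (hd0 : d ≠ 0)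
    (hd : ∀ k : ℕ, d * q ^ k ≠ 1) (hs : Summable (foldedTerm q b c β γ d)) :
    (1 - d) * (1 - β * b * c * d / q ^ 2) * (1 - γ * b * c * d / q ^ 2)
        * ∑' n, foldedTerm q b c β γ d n
      = (1 - b * d / q) * (1 - c * d / q) * (1 - β * γ * b * c * d / q ^ 2)
        * ∑' n, foldedTerm q b c β γ (d * q) n := by
  have hs' := hs.foldedTerm_mul_q h hd0 hd
  have h1 := (((hs.hasSum.mul_left ((1 - d) * (1 - β * b * c * d / q ^ 2)
    * (1 - γ * b * c * d / q ^ 2))).sub (hs'.hasSum.mul_left ((1 - b * d / q) * (1 - c * d / q)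
    * (1 - β * γ * b * c * d / q ^ 2)))).tendsto_sum_nat).comp (tendsto_add_atTop_nat 1)
  have h2 : Tendsto (fun N => - ((1 - d) * (b * c * d / q ^ 2) * liuFlux q b c β γ d N)) atTop
      (𝓝 0) := by
    simpa using ((tendsto_liuFlux h hd0 hs).const_mul ((1 - d) * (b * c * d / q ^ 2))).neg
  have h3 := tendsto_nhds_unique h1 (h2.congr fun N => (sum_foldedTerm_contiguous h hd N).symm)
  exact sub_eq_zero.mp h3

/-! ### The limit `d → 0` and the value of the sum -/

open Filter Topology in
theorem summable_prod_range_of_tendsto {t : ℕ → ℝ} {l : ℝ} (ht0 : ∀ n, 0 ≤ t n) (hl : l < 1)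
    (ht : Tendsto t atTop (𝓝 l)) : Summable fun n => ∏ i ∈ Finset.range n, t i := by
  obtain ⟨r, hlr, hr⟩ := exists_between hl
  refine summable_of_ratio_norm_eventually_le hr ?_
  filter_upwards [ht.eventually_le_const hlr] with n hn
  rw [Finset.prod_range_succ, norm_mul, Real.norm_of_nonneg (ht0 n), mul_comm]
  exact mul_le_mul_of_nonneg_right hn (norm_nonneg _)

theorem norm_liuWeight_mul_liuG_le {q b c β γ d : ℂ} {C ρ : ℝ} {t : ℕ → ℝ}
    (hG : ∀ n : ℕ, ‖liuG q b c β γ n‖ ≤ C * ρ ^ n)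
    (ht : ∀ i, ‖liuRatio q b c (q ^ i) * ((d - q * q ^ i) / (1 - d * q ^ i))‖ ≤ t i) (n : ℕ) :
    ‖liuWeight q b c d n * liuG q b c β γ n‖ ≤ C * ∏ i ∈ Finset.range n, (t i * ρ) := by
  have h1 : ‖liuWeight q b c d n‖ ≤ ∏ i ∈ Finset.range n, t i := by
    rw [liuWeight, norm_prod]
    exact Finset.prod_le_prod (fun _ _ => norm_nonneg _) fun i _ => ht i
  have h2 : 0 ≤ ∏ i ∈ Finset.range n, t i := (norm_nonneg _).trans h1
  calc ‖liuWeight q b c d n * liuG q b c β γ n‖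
      ≤ (∏ i ∈ Finset.range n, t i) * (C * ρ ^ n) := by
        rw [norm_mul]; exact mul_le_mul h1 (hG n) (norm_nonneg _) h2
    _ = C * ∏ i ∈ Finset.range n, (t i * ρ) := by
        rw [Finset.prod_mul_distrib, Finset.prod_const, Finset.card_range]; ring

theorem norm_foldedTerm_le {q : ℂ} (hq : ‖q‖ < 1) (b c β γ d : ℂ) (n : ℕ) :
    ‖foldedTerm q b c β γ d n‖ ≤ 2 * ‖liuWeight q b c d n * liuG q b c β γ n‖ := by
  rw [foldedTerm, norm_mul]
  refine mul_le_mul_of_nonneg_right ?_ (norm_nonneg _)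
  split_ifs
  · simp
  · refine (norm_add_le _ _).trans ?_
    rw [norm_one, norm_pow]
    have := pow_le_one₀ (n := n) (norm_nonneg q) hq.le
    linarith

open Filter Topology in
/-- The folded sum is continuous at `d = 0`: for small `d` its terms are dominated by a product whose
factors tend to a number less than `1`. -/
theorem tendsto_tsum_foldedTerm {q b c β γ : ℂ} (h : LiuAdmissible q b c β γ) :
    Tendsto (fun d => ∑' n, foldedTerm q b c β γ d n) (𝓝 0)
      (𝓝 (∑' n, foldedTerm q b c β γ 0 n)) := by
  set ρ : ℝ := ‖β‖ + ‖γ‖ + 1 with hρ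
  have hβ0 := norm_nonneg β
  have hγ0 := norm_nonneg γ
  obtain ⟨C, hC⟩ := exists_norm_liuG_le h.q_ne_zero h.norm_q h.b_ne_zero h.c_ne_zero h.qb_pow
    h.qc_pow h.βγ_pow (ρ := ρ) (by linarith) (by linarith)
  set M : ℝ := ‖b * c / q ^ 2‖ * ρ with hM
  have hM0 : 0 ≤ M := mul_nonneg (norm_nonneg _) (by linarith)
  -- With this radius `r`, the limiting ratio `M r / (1 - r)` equals `M / (M + 1)`.
  set r : ℝ := 1 / (M + 2) with hr
  have hr0 : 0 < r := by positivity
  have hr1 : 0 < 1 - r := by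
    have : 1 - r = (M + 1) / (M + 2) := by rw [hr]; field_simp; ring
    rw [this]; positivity
  set t : ℕ → ℝ := fun i => ‖liuRatio q b c (q ^ i)‖ * ((r + ‖q * q ^ i‖) / (1 - r)) with ht
  have hx := tendsto_pow_atTop_nhds_zero_of_norm_lt_one h.norm_q
  have hR : Tendsto (fun i : ℕ => liuRatio q b c (q ^ i)) atTop (𝓝 (b * c / q ^ 2)) := by
    have : ContinuousAt (liuRatio q b c) 0 := by
      unfold liuRatio
      exact ContinuousAt.div (by fun_prop) (by fun_prop) (by simp)
    have h1 := this.tendsto.comp hx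
    have e : liuRatio q b c 0 = b * c / q ^ 2 := by simp [liuRatio]
    rwa [e] at h1
  have htl : Tendsto (fun i => t i * ρ) atTop (𝓝 (M / (M + 1))) := by
    have h1 := (hR.norm.mul (((hx.const_mul q).norm.const_add r).div_const (1 - r))).mul_const ρ
    have e : ‖b * c / q ^ 2‖ * ((r + ‖q * 0‖) / (1 - r)) * ρ = M / (M + 1) := by
      rw [mul_zero, norm_zero, add_zero, mul_right_comm, ← hM, hr]
      have : 1 - 1 / (M + 2) = (M + 1) / (M + 2) := by field_simp; ring
      rw [this]
      field_simp
    rwa [e] at h1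
  have hsum : Summable fun n => 2 * (C * ∏ i ∈ Finset.range n, (t i * ρ)) :=
    ((summable_prod_range_of_tendsto (fun i => by positivity)
      (by rw [div_lt_one (by positivity)]; linarith) htl).mul_left C).mul_left 2
  refine tendsto_tsum_of_dominated_convergence hsum (fun n => ?_) ?_
  · have : ContinuousAt (fun d => foldedTerm q b c β γ d n) 0 := by
      unfold foldedTerm liuWeight
      refine ContinuousAt.mul (by fun_prop) (ContinuousAt.mul ?_ (by fun_prop))
      refine tendsto_finsetProd _ fun i _ => ?_
      exact ContinuousAt.mul (by fun_prop) (ContinuousAt.div (by fun_prop) (by fun_prop) (by simp))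
    exact this.tendsto
  · filter_upwards [Metric.closedBall_mem_nhds (0 : ℂ) hr0] with d hd n
    rw [mem_closedBall_zero_iff] at hd
    refine (norm_foldedTerm_le h.norm_q b c β γ d n).trans ?_
    refine mul_le_mul_of_nonneg_left
      (norm_liuWeight_mul_liuG_le hC (fun i => ?_) n) zero_le_two
    rw [norm_mul, norm_div]
    refine mul_le_mul_of_nonneg_left (div_le_div₀ (by positivity) ?_ hr1 ?_) (norm_nonneg _)
    · exact (norm_sub_le _ _).trans (by linarith)
    · have h1 := norm_sub_norm_le 1 (d * q ^ i)
      have h2 : ‖d * q ^ i‖ ≤ r := by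
        rw [norm_mul, norm_pow]
        exact (mul_le_of_le_one_right (norm_nonneg _)
          (pow_le_one₀ (norm_nonneg q) h.norm_q.le)).trans hd
      rw [norm_one] at h1
      linarith

theorem tsum_foldedTerm_iterate {q b c β γ d : ℂ} (h : LiuAdmissible q b c β γ) (hd0 : d ≠ 0)
    (hd : ∀ k : ℕ, d * q ^ k ≠ 1) (hs : Summable (foldedTerm q b c β γ d)) (N : ℕ) :
    Summable (foldedTerm q b c β γ (d * q ^ N)) ∧
    (∏ i ∈ Finset.range N, (1 - d * q ^ i))
        * (∏ i ∈ Finset.range N, (1 - β * b * c * d / q ^ 2 * q ^ i))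
        * (∏ i ∈ Finset.range N, (1 - γ * b * c * d / q ^ 2 * q ^ i))
        * ∑' n, foldedTerm q b c β γ d n
      = (∏ i ∈ Finset.range N, (1 - b * d / q * q ^ i))
        * (∏ i ∈ Finset.range N, (1 - c * d / q * q ^ i))
        * (∏ i ∈ Finset.range N, (1 - β * γ * b * c * d / q ^ 2 * q ^ i))
        * ∑' n, foldedTerm q b c β γ (d * q ^ N) n := by
  induction N with
  | zero => simpa using hs
  | succ N ih =>
    have hd0' : d * q ^ N ≠ 0 := mul_ne_zero hd0 (pow_ne_zero _ h.q_ne_zero)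
    have hd' : ∀ k : ℕ, d * q ^ N * q ^ k ≠ 1 := fun k => by
      rw [mul_assoc, ← pow_add]; exact hd _
    have e : d * q ^ (N + 1) = d * q ^ N * q := by ring
    have hc := tsum_foldedTerm_contiguous h hd0' hd' ih.1
    rw [e]
    refine ⟨ih.1.foldedTerm_mul_q h hd0' hd', ?_⟩
    simp only [Finset.prod_range_succ]
    have e1 : ∀ a : ℂ, a * (d * q ^ N) / q ^ 2 = a * d / q ^ 2 * q ^ N := fun a => by ring
    have e2 : ∀ a : ℂ, a * (d * q ^ N) / q = a * d / q * q ^ N := fun a => by ring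
    rw [e1, e1, e1, e2, e2] at hc
    linear_combination (1 - d * q ^ N) * (1 - β * b * c * d / q ^ 2 * q ^ N)
      * (1 - γ * b * c * d / q ^ 2 * q ^ N) * ih.2
      + (∏ i ∈ Finset.range N, (1 - b * d / q * q ^ i))
        * (∏ i ∈ Finset.range N, (1 - c * d / q * q ^ i))
        * (∏ i ∈ Finset.range N, (1 - β * γ * b * c * d / q ^ 2 * q ^ i)) * hc

open Filter Topology in
/-- The limit of the iterated contiguous relation, which expresses the sum for `d` through the sum
for `d = 0`. -/
theorem tsum_foldedTerm_eq_zero_value {q b c β γ d : ℂ} (h : LiuAdmissible q b c β γ) (hd0 : d ≠ 0)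
    (hd : ∀ k : ℕ, d * q ^ k ≠ 1) (hs : Summable (foldedTerm q b c β γ d)) :
    qPochInf d q * qPochInf (β * b * c * d / q ^ 2) q * qPochInf (γ * b * c * d / q ^ 2) q
        * ∑' n, foldedTerm q b c β γ d n
      = qPochInf (b * d / q) q * qPochInf (c * d / q) q * qPochInf (β * γ * b * c * d / q ^ 2) q
        * ∑' n, foldedTerm q b c β γ 0 n := by
  have hP : ∀ a : ℂ, Tendsto (fun N => ∏ i ∈ Finset.range N, (1 - a * q ^ i)) atTop
      (𝓝 (qPochInf a q)) := fun a => (multipliable_qPochInf a h.norm_q).hasProd.tendsto_prod_nat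
  have hx : Tendsto (fun N : ℕ => d * q ^ N) atTop (𝓝 0) := by
    simpa using (tendsto_pow_atTop_nhds_zero_of_norm_lt_one h.norm_q).const_mul d
  have h1 := (((hP d).mul (hP (β * b * c * d / q ^ 2))).mul
    (hP (γ * b * c * d / q ^ 2))).mul_const (∑' n, foldedTerm q b c β γ d n)
  have h2 := (((hP (b * d / q)).mul (hP (c * d / q))).mul
    (hP (β * γ * b * c * d / q ^ 2))).mul ((tendsto_tsum_foldedTerm h).comp hx)
  exact tendsto_nhds_unique h1
    (h2.congr fun N => (tsum_foldedTerm_iterate h hd0 hd hs N).2.symm)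

/-- At `d = q` only the `0`-th term survives, which determines the sum for `d = 0`. -/
theorem tsum_foldedTerm_zero {q b c β γ : ℂ} (h : LiuAdmissible q b c β γ) :
    qPochInf q q * qPochInf (β * b * c / q) q * qPochInf (γ * b * c / q) q
      = qPochInf b q * qPochInf c q * qPochInf (β * γ * b * c / q) q
        * ∑' n, foldedTerm q b c β γ 0 n := by
  have hz : ∀ n, n ≠ 0 → foldedTerm q b c β γ q n = 0 := by
    intro n hn
    have : liuWeight q b c q n = 0 :=
      Finset.prod_eq_zero (Finset.mem_range.mpr (Nat.pos_of_ne_zero hn)) (by simp)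
    rw [foldedTerm, this, zero_mul, mul_zero]
  have h0 : foldedTerm q b c β γ q 0 = 1 := by
    rw [foldedTerm, liuG_zero h.q_ne_zero]; simp [liuWeight]
  have hsum := hasSum_single (f := foldedTerm q b c β γ q) 0 hz
  have hqq : ∀ k : ℕ, q * q ^ k ≠ 1 := fun k => by
    rw [← pow_succ']; exact pow_ne_one_of_norm_lt_one h.norm_q (by omega)
  have key := tsum_foldedTerm_eq_zero_value h h.q_ne_zero hqq hsum.summable
  rw [hsum.tsum_eq, h0, mul_one] at key
  have hq0 := h.q_ne_zero
  have e1 : ∀ a : ℂ, a * q / q ^ 2 = a / q := fun a => by field_simp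
  simpa only [e1, mul_div_cancel_right₀ _ hq0] using key

/-! ### The bilateral series -/

theorem qPochInf_ne_zero {a q : ℂ} (hq : ‖q‖ < 1) (ha : ∀ k : ℕ, a * q ^ k ≠ 1) :
    qPochInf a q ≠ 0 := by
  have h : Summable fun k : ℕ => ‖-(a * q ^ k)‖ := by
    simp only [norm_neg, norm_mul, norm_pow]
    exact (summable_geometric_of_lt_one (norm_nonneg q) hq).mul_left _
  have := tprod_one_add_ne_zero_of_summable (f := fun k : ℕ => -(a * q ^ k))
    (fun k => by rw [← sub_eq_add_neg]; exact sub_ne_zero.mpr (ha k).symm) h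
  simpa [qPochInf, sub_eq_add_neg] using this

theorem qPoch_neg_natCast (a q : ℂ) (n : ℕ) :
    qPoch a q (-(n : ℤ)) = (∏ k ∈ Finset.range n, (1 - a * q ^ (-((k : ℤ) + 1))))⁻¹ := by
  cases n with
  | zero => simpa using qPoch_natCast a q 0
  | succ n => rfl

/-- The reflection `n ↦ -n` of a quotient `(q/a; q)_n / (a; q)_n`. No factor has to be nonzero: the
quotients agree factor by factor, also where a denominator vanishes. -/
theorem qPoch_div_neg {a q : ℂ} (hq0 : q ≠ 0) (ha0 : a ≠ 0) (n : ℕ) :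
    qPoch (q / a) q (-(n : ℤ)) / qPoch a q (-(n : ℤ))
      = (a ^ 2 / q) ^ n * (qPoch (q / a) q n / qPoch a q n) := by
  rw [qPoch_neg_natCast, qPoch_neg_natCast, qPoch_natCast, qPoch_natCast, inv_div_inv,
    ← Finset.prod_div_distrib, ← Finset.prod_div_distrib, ← Finset.card_range n,
    ← Finset.prod_const, Finset.card_range, ← Finset.prod_mul_distrib]
  refine Finset.prod_congr rfl fun k _ => ?_
  have hk : q ^ k ≠ 0 := pow_ne_zero _ hq0
  have e : q ^ (-((k : ℤ) + 1)) = (q ^ k * q)⁻¹ := by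
    rw [zpow_neg, zpow_add_one₀ hq0, zpow_natCast]
  have e1 : 1 - a * (q ^ k * q)⁻¹ = -(a / (q * q ^ k)) * (1 - q / a * q ^ k) := by
    field_simp; ring
  have e2 : 1 - q / a * (q ^ k * q)⁻¹ = -(1 / (a * q ^ k)) * (1 - a * q ^ k) := by
    field_simp; ring
  rw [e, e1, e2, mul_div_mul_comm]
  congr 1
  field_simp

theorem liuWeight_eq {q b c d : ℂ} (hd0 : d ≠ 0) (n : ℕ) :
    qPochs [q / b, q / c, q / d] q n / qPochs [b, c, d] q n * (b * c * d / q ^ 2) ^ n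
      = liuWeight q b c d n := by
  simp only [qPochs, List.map_cons, List.map_nil, List.prod_cons, List.prod_nil, mul_one,
    qPoch_natCast, liuWeight, ← Finset.prod_mul_distrib, ← Finset.prod_div_distrib]
  rw [← Finset.card_range n, ← Finset.prod_const, Finset.card_range, ← Finset.prod_mul_distrib]
  refine Finset.prod_congr rfl fun k _ => ?_
  have e1 : d - q * q ^ k = d * (1 - q / d * q ^ k) := by field_simp
  have e2 : ∀ a : ℂ, 1 - q * q ^ k / a = 1 - q / a * q ^ k := fun a => by ring
  rw [liuRatio, e1, e2, e2]
  generalize 1 - b * q ^ k = u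
  generalize 1 - c * q ^ k = v
  generalize 1 - d * q ^ k = w
  ring

theorem qPochs_div_neg {q b c d : ℂ} (hq0 : q ≠ 0) (hb0 : b ≠ 0) (hc0 : c ≠ 0) (hd0 : d ≠ 0)
    (n : ℕ) :
    qPochs [q / b, q / c, q / d] q (-(n : ℤ)) / qPochs [b, c, d] q (-(n : ℤ))
        * (b * c * d / q ^ 2) ^ (-(n : ℤ))
      = q ^ n * liuWeight q b c d n := by
  have hb := qPoch_div_neg hq0 hb0 n
  have hc := qPoch_div_neg hq0 hc0 n
  have hd := qPoch_div_neg hq0 hd0 n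
  rw [← liuWeight_eq hd0]
  simp only [qPochs, List.map_cons, List.map_nil, List.prod_cons, List.prod_nil, mul_one]
  rw [mul_div_mul_comm, mul_div_mul_comm, hb, hc, hd, zpow_neg, zpow_natCast, ← inv_pow,
    mul_div_mul_comm (qPoch (q / b) q n), mul_div_mul_comm (qPoch (q / c) q n)]
  have e : q ^ n * (b * c * d / q ^ 2) ^ n
      = (b ^ 2 / q) ^ n * (c ^ 2 / q) ^ n * (d ^ 2 / q) ^ n * (b * c * d / q ^ 2)⁻¹ ^ n := by
    simp only [← mul_pow]
    congr 1
    field_simp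
  linear_combination - (qPoch (q / b) q n / qPoch b q n * (qPoch (q / c) q n / qPoch c q n)
    * (qPoch (q / d) q n / qPoch d q n)) * e

theorem mainTheorem10 (q b c d β γ : ℂ) (hq0 : q ≠ 0) (hq : ‖q‖ < 1)
    (hb0 : b ≠ 0) (hc0 : c ≠ 0) (hd0 : d ≠ 0)
    (hb : ∀ k : ℕ, b * q ^ k ≠ 1) (hc : ∀ k : ℕ, c * q ^ k ≠ 1) (hd : ∀ k : ℕ, d * q ^ k ≠ 1)
    (hqb : ∀ k : ℕ, q / b * q ^ k ≠ 1) (hqc : ∀ k : ℕ, q / c * q ^ k ≠ 1)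
    (hβγ : ∀ k : ℕ, β * γ * b * c / q * q ^ k ≠ 1)
    (hx : ‖b * c * d / q ^ 2‖ < 1) :
    let T : ℤ → ℂ := fun n =>
      liuG q b c β γ n * (qPochs [q / b, q / c, q / d] q n / qPochs [b, c, d] q n)
        * (b * c * d / q ^ 2) ^ n
    let R : ℂ :=
      qPochsInf [q, β * b * c / q, γ * b * c / q, b * d / q, c * d / q,
          β * γ * b * c * d / q ^ 2] q
        / qPochsInf [b, c, d, β * γ * b * c / q, β * b * c * d / q ^ 2,
          γ * b * c * d / q ^ 2] q
    (‖β * b * c * d / q ^ 2‖ < 1 → ‖γ * b * c * d / q ^ 2‖ < 1 → HasSum T R) ∧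
      ((∀ k : ℕ, β * b * c * d / q ^ 2 * q ^ k ≠ 1) →
        (∀ k : ℕ, γ * b * c * d / q ^ 2 * q ^ k ≠ 1) → Summable T → HasSum T R) := by
  intro T R
  have h : LiuAdmissible q b c β γ := ⟨hq0, hq, hb0, hc0, hb, hc, hqb, hqc, hβγ⟩
  have hTn : ∀ n : ℕ, T n = liuWeight q b c d n * liuG q b c β γ n := fun n => by
    rw [← liuWeight_eq hd0, ← zpow_natCast]
    simp only [T]
    ring
  have hTneg : ∀ n : ℕ, T (-n) = q ^ n * (liuWeight q b c d n * liuG q b c β γ n) := fun n => by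
    rw [← mul_assoc, ← qPochs_div_neg hq0 hb0 hc0 hd0]
    simp only [T, liuG_neg]
    ring
  have main : (∀ k : ℕ, β * b * c * d / q ^ 2 * q ^ k ≠ 1) →
      (∀ k : ℕ, γ * b * c * d / q ^ 2 * q ^ k ≠ 1) → Summable T → HasSum T R := by
    intro hβ hγ hs
    have hT0 : T 0 = 1 := by
      have := hTn 0
      rw [liuG_zero hq0] at this
      simpa [liuWeight] using this
    have hfold : HasSum (foldedTerm q b c β γ d) (∑' n, T n) := by
      have h1 := hs.hasSum.nat_add_neg.sub (hasSum_ite_eq (0 : ℕ) (1 : ℂ))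
      rw [hT0, add_sub_cancel_right] at h1
      refine (funext fun n => ?_ : foldedTerm q b c β γ d = _) ▸ h1
      rw [hTn, hTneg, foldedTerm]
      rcases eq_or_ne n 0 with rfl | hn
      · rw [if_pos rfl, if_pos rfl, ← hTn, Nat.cast_zero, hT0]
        ring
      · rw [if_neg hn, if_neg hn]
        ring
    have h1 := tsum_foldedTerm_eq_zero_value h hd0 hd hfold.summable
    have h2 := tsum_foldedTerm_zero h
    rw [hfold.tsum_eq] at h1
    have e : ∑' n, T n = R := by
      have n1 := qPochInf_ne_zero hq hb
      have n2 := qPochInf_ne_zero hq hc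
      have n3 := qPochInf_ne_zero hq hd
      have n4 := qPochInf_ne_zero hq hβγ
      have n5 := qPochInf_ne_zero hq hβ
      have n6 := qPochInf_ne_zero hq hγ
      simp only [R, qPochsInf, List.map_cons, List.map_nil, List.prod_cons, List.prod_nil, mul_one]
      rw [eq_div_iff (by simp only [ne_eq, mul_eq_zero, not_or]; tauto)]
      linear_combination qPochInf b q * qPochInf c q * qPochInf (β * γ * b * c / q) q * h1
        - qPochInf (b * d / q) q * qPochInf (c * d / q) q
          * qPochInf (β * γ * b * c * d / q ^ 2) q * h2
    rw [← e]
    exact hs.hasSum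
  refine ⟨fun hβ hγ => ?_, main⟩
  have hne : ∀ a : ℂ, ‖a‖ < 1 → ∀ k : ℕ, a * q ^ k ≠ 1 := by
    intro a ha k hk
    have h1 : ‖a * q ^ k‖ ≤ ‖a‖ := by
      rw [norm_mul, norm_pow]
      exact mul_le_of_le_one_right (norm_nonneg a) (pow_le_one₀ (norm_nonneg q) hq.le)
    rw [hk, norm_one] at h1
    linarith
  refine main (hne _ hβ) (hne _ hγ) ?_
  set X : ℝ := ‖b * c * d / q ^ 2‖ with hX
  have hX0 : 0 < X := norm_pos_iff.mpr
    (div_ne_zero (mul_ne_zero (mul_ne_zero hb0 hc0) hd0) (pow_ne_zero _ hq0))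
  have hlt : ∀ a : ℂ, ‖a * b * c * d / q ^ 2‖ < 1 → ‖a‖ < X⁻¹ := fun a ha => by
    have e : a * b * c * d / q ^ 2 = a * (b * c * d / q ^ 2) := by ring
    rw [e, norm_mul, ← hX] at ha
    rwa [← one_div, lt_div_iff₀ hX0]
  -- Any `ρ` with `max ‖β‖ ‖γ‖ < ρ < 1 / ‖bcd/q²‖` makes `ρ ^ n` a sufficient bound for `G(n; β, γ)`.
  obtain ⟨ρ, hρ1, hρ2⟩ := exists_between (max_lt (hlt β hβ) (hlt γ hγ))
  obtain ⟨C, hC⟩ := exists_norm_liuG_le hq0 hq hb0 hc0 hqb hqc hβγ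
    ((le_max_left _ _).trans_lt hρ1) ((le_max_right _ _).trans_lt hρ1)
  have hρ0 : 0 ≤ ρ := ((norm_nonneg β).trans (le_max_left _ _)).trans hρ1.le
  have hs : Summable fun n : ℕ => liuWeight q b c d n * liuG q b c β γ n :=
    Summable.of_norm_bounded
      ((summable_prod_range_of_tendsto (fun i => mul_nonneg (norm_nonneg _) hρ0)
        (by rwa [← lt_inv_mul_iff₀ hX0, mul_one])
        ((tendsto_weight_ratio d hq).norm.mul_const ρ)).mul_left C)
      (norm_liuWeight_mul_liuG_le hC fun i => le_rfl)
  refine Summable.of_nat_of_neg (hs.congr fun n => (hTn n).symm) ?_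
  refine Summable.of_norm_bounded hs.norm fun n => ?_
  rw [hTneg, norm_mul, norm_pow]
  exact mul_le_of_le_one_left (norm_nonneg _) (pow_le_one₀ (norm_nonneg q) hq.le)
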